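/- All graphs are finite, simple and undirected, and a strongly regular graph is required to be neither complete nor edgeless (complete multipartite graphs and disjoint unions of cliques are allowed). A Deza graph with parameters $(n,k,b,a)$, $b\geqslant a$, is a $k$-regular graph on $n$ vertices, neither complete nor edgeless, for which the numbers of common neighbours of pairs of distinct vertices are exactly $b$ and $a$ (both values occur). Its children $G_A$ and $G_B$ are the graphs on the same vertex set in which two distinct vertices are adjacent if and only if they have $a$, respectively $b$, common neighbours in $G$ (if $b=a$, then $G_A$ is complete and $G_B$ is edgeless). A Deza graph is strongly Deza if both its children are strongly regular. A connected graph $G$ of diameter $d$ is distance-regular with intersection numbers $a_i,b_i,c_i$ ($0\leqslant i\leqslant d$) if for all vertices $x,y$ at distance $i$ the number of neighbours of $y$ at distance $i$, $i+1$, $i-1$ from $x$ equals $a_i$, $b_i$, $c_i$, respectively. Two graphs are cospectral if their adjacency matrices have the same eigenvalues with the same multiplicities. **Proposition.** Let $G$ be a distance-regular graph of diameter $3$ with $a_1=c_2$ which is a strongly Deza graph with parameters $(n,k,b,a)$, and let $G'$ be a graph cospectral with $G$. If $G'$ is a Deza graph, with parameters $(n',k',b',a')$, then $G'$ is a strongly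 Deza graph (with these parameters), and at least one of the following holds: (i) $G'$ is distance-regular (of diameter $3$) with the same intersection numbers as $G$; (ii) $G'$ and $G$ have different parameters $a$ and $b$ as Deza graphs, that is, $a'\neq a$ and $b'\neq b$. -/

import Mathlib

namespace SimpleGraph

/-- `G` is a Deza graph with parameters `(n, k, b, a)`: a `k`-regular graph of order `n`, neither
complete nor edgeless, in which the numbers of common neighbours of two distinct vertices are
exactly `b` and `a`, where `b ≥ a` (both occur, so the parameters are determined by the graph). -/
structure IsDeza {V : Type*} [Fintype V] (G : SimpleGraph V) (n k b a : ℕ) : Prop where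
  card : Fintype.card V = n
  regular : ∀ v, (G.neighborSet v).ncard = k
  le : a ≤ b
  common : ∀ v w, v ≠ w →
    (G.commonNeighbors v w).ncard = b ∨ (G.commonNeighbors v w).ncard = a
  exists_b : ∃ v w, v ≠ w ∧ (G.commonNeighbors v w).ncard = b
  exists_a : ∃ v w, v ≠ w ∧ (G.commonNeighbors v w).ncard = a
  ne_top : G ≠ ⊤
  ne_bot : G ≠ ⊥

/-- The child `G_A`: distinct vertices are adjacent iff they have `a` common neighbours.
(For a Deza graph with `b = a` this is the complete graph.) -/
def childA {V : Type*} (G : SimpleGraph V) (a : ℕ) : SimpleGraph V where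
  Adj v w := v ≠ w ∧ (G.commonNeighbors v w).ncard = a
  symm := ⟨fun v w h => ⟨h.1.symm, by rw [commonNeighbors_symm]; exact h.2⟩⟩
  loopless := ⟨fun _ h => h.1 rfl⟩

/-- The child `G_B`: distinct vertices are adjacent iff they have `b` common neighbours, with the
convention that it is edgeless if `b = a`. -/
def childB {V : Type*} (G : SimpleGraph V) (b a : ℕ) : SimpleGraph V where
  Adj v w := b ≠ a ∧ v ≠ w ∧ (G.commonNeighbors v w).ncard = b
  symm := ⟨fun v w h => ⟨h.1, h.2.1.symm, by rw [commonNeighbors_symm]; exact h.2.2⟩⟩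
  loopless := ⟨fun _ h => h.2.1 rfl⟩

open Classical in
/-- Strongly regular graphs; as usual, complete and edgeless graphs are excluded, whereas complete
multipartite graphs and disjoint unions of complete graphs are allowed. -/
def IsStronglyRegular {V : Type*} [Fintype V] (G : SimpleGraph V) : Prop :=
  G ≠ ⊤ ∧ G ≠ ⊥ ∧ ∃ n k l m : ℕ, G.IsSRGWith n k l m

/-- `G` is a strongly Deza graph with parameters `(n, k, b, a)`: a Deza graph both of whose
children are strongly regular. -/
structure IsStronglyDeza {V : Type*} [Fintype V] (G : SimpleGraph V) (n k b a : ℕ) : Prop where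
  isDeza : G.IsDeza n k b a
  childA_srg : (G.childA a).IsStronglyRegular
  childB_srg : (G.childB b a).IsStronglyRegular

/-- `G` is distance-regular of diameter `d` with intersection numbers
`ia i`, `ib i`, `ic i` for `0 ≤ i ≤ d`. (The values for `i > d` are irrelevant.) -/
structure IsDistanceRegular {V : Type*} (G : SimpleGraph V) (d : ℕ) (ia ib ic : ℕ → ℕ) :
    Prop where
  connected : G.Connected
  diam_eq : G.diam = d
  card_succ : ∀ i ≤ d, ∀ x y, G.dist x y = i →
    {z | G.Adj y z ∧ G.dist x z = i + 1}.ncard = ib i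
  card_same : ∀ i ≤ d, ∀ x y, G.dist x y = i →
    {z | G.Adj y z ∧ G.dist x z = i}.ncard = ia i
  card_pred : ∀ i ≤ d, ∀ x y, G.dist x y = i →
    {z | G.Adj y z ∧ G.dist x z + 1 = i}.ncard = ic i

open Classical in
/-- The spectrum of a finite graph: the multiset of eigenvalues of its adjacency matrix,
counted with multiplicity. -/
noncomputable def adjSpectrum {V : Type*} [Fintype V] (G : SimpleGraph V) : Multiset ℝ :=
  (G.adjMatrix ℝ).charpoly.roots

/-- Cospectral graphs: the adjacency spectra agree, with multiplicities. -/
def IsCospectral {V W : Type*} [Fintype V] [Fintype W] (G : SimpleGraph V)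
    (H : SimpleGraph W) : Prop :=
  G.adjSpectrum = H.adjSpectrum

end SimpleGraph

/-! Cospectral real symmetric matrices are orthogonally conjugate, so there is a trace-preserving
algebra isomorphism `f` of the matrix algebras with `f A = A'`. As `G` is connected and regular, the
valency `k` is a simple eigenvalue with the constant vectors as eigenspace; this forces `f J = J`.
Hence any identity in `A`, `I` and `J` passes between `G` and `G'`.

For a Deza graph, `A² = (k-a)I + aJ + (b-a)B`, with `B` the matrix of the child `G_B`. If `b ≠ a`,
then `G_B` is strongly regular exactly when `A²` satisfies a quadratic relation modulo `J`. That
relation is carried over by `f`, and the other child is the complement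
(`IsStronglyDeza.of_isCospectral`).

For the dichotomy, `a₁ = c₂` means that vertices at distance 1 or 2 have `c₂` common neighbours and
those at distance 3 have none. So `a = 0`, `b = c₂`, and `G_A` is the distance-3 graph, with matrix
`A₃`. The trace of `A²(A² - bJ)` shows that agreement in one of `a`, `b` implies agreement in both
(`IsDeza.params_eq_of_isCospectral`). Then `f` maps `A₃` to the matrix of the corresponding child of
`G'`, and the relation `A A₃ = b₂A₂ + a₃A₃`, where `A₂ = J - I - A - A₃`, holds in `G'` as well.
Together with the common-neighbour counts it forces distance-regularity (`isDistanceRegular_three`).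
-/

open Matrix
-- Conjugacy of symmetric matrices with equal spectra.
namespace Matrix

/-- The all-ones matrix. -/
def allOnes (V : Type*) : Matrix V V ℝ := of fun _ _ => 1

@[simp] theorem allOnes_apply {V : Type*} (v w : V) : allOnes V v w = 1 := rfl

theorem mul_allOnes_apply {V : Type*} [Fintype V] (M : Matrix V V ℝ) (v w : V) :
    (M * allOnes V) v w = ∑ u, M v u := by
  simp [mul_apply]

theorem allOnes_mul_apply {V : Type*} [Fintype V] (M : Matrix V V ℝ) (v w : V) :
    (allOnes V * M) v w = ∑ u, M u w := by
  simp [mul_apply]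

theorem allOnes_mul_allOnes {V : Type*} [Fintype V] :
    allOnes V * allOnes V = (Fintype.card V : ℝ) • allOnes V := by
  ext v w
  simp [mul_apply]

/-- Multiset-equal families are equal up to a bijection of the index types. -/
theorem _root_.exists_equiv_of_map_univ_eq {V W α : Type*} [Fintype V] [Fintype W]
    (f : V → α) (g : W → α)
    (h : Multiset.map f Finset.univ.val = Multiset.map g Finset.univ.val) :
    ∃ e : V ≃ W, ∀ v, g (e v) = f v := by
  classical
  have key : ∀ x, Nonempty ({v // f v = x} ≃ {w // g w = x}) := fun x => by
    have := congrArg (Multiset.count x) h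
    rw [Multiset.count_map, Multiset.count_map] at this
    refine ⟨Fintype.equivOfCardEq ?_⟩
    rw [Fintype.card_subtype, Fintype.card_subtype, Finset.card_def, Finset.card_def]
    simpa [Finset.filter_val, eq_comm] using this
  have e := fun x => Classical.choice (key x)
  refine ⟨((Equiv.sigmaFiberEquiv f).symm.trans
    (Equiv.sigmaCongrRight e)).trans (Equiv.sigmaFiberEquiv g), fun v => ?_⟩
  exact (e (f v) ⟨v, rfl⟩).2

theorem trace_conjStarAlgAut {V : Type*} [Fintype V] [DecidableEq V]
    (U : unitary (Matrix V V ℝ)) (M : Matrix V V ℝ) :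
    (Unitary.conjStarAlgAut ℝ _ U M).trace = M.trace := by
  rw [Unitary.conjStarAlgAut_apply, trace_mul_comm, ← mul_assoc]
  simp

/-- Real symmetric matrices with the same spectrum are conjugate. -/
theorem IsHermitian.exists_algEquiv_of_roots_charpoly_eq {V W : Type*} [Fintype V] [Fintype W]
    [DecidableEq V] [DecidableEq W] {A : Matrix V V ℝ} {B : Matrix W W ℝ}
    (hA : A.IsHermitian) (hB : B.IsHermitian) (h : A.charpoly.roots = B.charpoly.roots) :
    ∃ f : Matrix V V ℝ ≃ₐ[ℝ] Matrix W W ℝ, (∀ M, (f M).trace = M.trace) ∧ f A = B := by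
  rw [hA.roots_charpoly_eq_eigenvalues, hB.roots_charpoly_eq_eigenvalues] at h
  obtain ⟨e, he⟩ := exists_equiv_of_map_univ_eq _ _ h
  -- Diagonalize `A`, reorder the eigenvalues by `e`, then undo the diagonalization of `B`.
  refine ⟨((Unitary.conjStarAlgAut ℝ _ (star hA.eigenvectorUnitary)).toAlgEquiv.trans
    (reindexAlgEquiv ℝ ℝ e)).trans
    (Unitary.conjStarAlgAut ℝ _ hB.eigenvectorUnitary).toAlgEquiv, fun M => ?_, ?_⟩
  · simp only [AlgEquiv.trans_apply, StarAlgEquiv.coe_toAlgEquiv, trace_conjStarAlgAut,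
      coe_reindexAlgEquiv]
    rw [← trace_conjStarAlgAut (star hA.eigenvectorUnitary) M]
    simp only [trace, diag, reindex_apply, submatrix_apply]
    exact Equiv.sum_comp e.symm fun i =>
      Unitary.conjStarAlgAut ℝ _ (star hA.eigenvectorUnitary) M i i
  · conv_rhs => rw [hB.spectral_theorem]
    simp only [AlgEquiv.trans_apply, StarAlgEquiv.coe_toAlgEquiv, coe_reindexAlgEquiv]
    congr 1
    rw [hA.conjStarAlgAut_star_eigenvectorUnitary]
    ext i j
    rw [reindex_apply, submatrix_apply, diagonal_apply, diagonal_apply]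
    have := he (e.symm i)
    rw [e.apply_symm_apply] at this
    simp only [Function.comp_apply] at this ⊢
    rw [this]
    simp

end Matrix
-- Adjacency matrices of regular, strongly regular and Deza graphs.
namespace SimpleGraph

open Classical in
theorem adjMatrix_mul_adjMatrix_apply {V : Type*} [Fintype V] (G H : SimpleGraph V) (v w : V) :
    (G.adjMatrix ℝ * H.adjMatrix ℝ) v w = ({z | G.Adj v z ∧ H.Adj z w}.ncard : ℝ) := by
  rw [adjMatrix_mul_apply]
  simp only [adjMatrix_apply, Finset.sum_boole]
  rw [Set.ncard_eq_toFinset_card']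
  congr 2
  ext z
  simp

open Classical in
theorem adjMatrix_sq_apply {V : Type*} [Fintype V] (G : SimpleGraph V) (v w : V) :
    (G.adjMatrix ℝ * G.adjMatrix ℝ) v w = ((G.commonNeighbors v w).ncard : ℝ) := by
  rw [adjMatrix_mul_adjMatrix_apply]
  congr 2
  ext z
  simp [mem_commonNeighbors, G.adj_comm z w]

theorem commonNeighbors_self {V : Type*} (G : SimpleGraph V) (v : V) :
    G.commonNeighbors v v = G.neighborSet v := by
  simp [commonNeighbors]

open Classical in
theorem degree_eq_ncard {V : Type*} [Fintype V] (G : SimpleGraph V) (v : V) :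
    G.degree v = (G.neighborSet v).ncard := by
  rw [← card_neighborSet_eq_degree, Set.ncard_eq_toFinset_card', Set.toFinset_card]

open Classical in
theorem sum_adjMatrix_row {V : Type*} [Fintype V] (G : SimpleGraph V) (v : V) :
    ∑ w, G.adjMatrix ℝ v w = ((G.neighborSet v).ncard : ℝ) := by
  rw [← degree_eq_ncard]
  simp [adjMatrix_apply, ← card_neighborFinset_eq_degree, neighborFinset_eq_filter]

open Classical in
theorem adjMatrix_mul_allOnes {V : Type*} [Fintype V] {G : SimpleGraph V} {k : ℕ}
    (h : ∀ v, (G.neighborSet v).ncard = k) :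
    G.adjMatrix ℝ * allOnes V = (k : ℝ) • allOnes V := by
  ext v w
  rw [mul_allOnes_apply, sum_adjMatrix_row, h]
  simp

open Classical in
theorem allOnes_mul_adjMatrix {V : Type*} [Fintype V] {G : SimpleGraph V} {k : ℕ}
    (h : ∀ v, (G.neighborSet v).ncard = k) :
    allOnes V * G.adjMatrix ℝ = (k : ℝ) • allOnes V := by
  ext v w
  have : ∀ u, G.adjMatrix ℝ u w = G.adjMatrix ℝ w u := fun u => by
    simp [adjMatrix_apply, G.adj_comm]
  rw [allOnes_mul_apply, Finset.sum_congr rfl fun u _ => this u, sum_adjMatrix_row, h]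
  simp

open Classical in
/-- In a connected regular graph the valency is a simple eigenvalue. -/
theorem Connected.apply_eq_of_adjMatrix_mul_eq {V : Type*} [Fintype V] {G : SimpleGraph V} {k : ℕ}
    (hG : G.Connected) (h : ∀ v, (G.neighborSet v).ncard = k) {M : Matrix V V ℝ}
    (hM : G.adjMatrix ℝ * M = (k : ℝ) • M) (v w u : V) : M v u = M w u := by
  -- By regularity the Laplacian is `kI - A`, so each column of `M` lies in its kernel, which
  -- consists of functions constant on components.
  have key : G.lapMatrix ℝ *ᵥ (fun x => M x u) = 0 := by
    ext x
    have := congrFun (congrFun hM x) u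
    rw [adjMatrix_mul_apply] at this
    rw [lapMatrix_mulVec_apply, this, degree_eq_ncard, h]
    simp
  exact (lapMatrix_mulVec_eq_zero_iff_forall_reachable G).1 key v w (hG v w)

open Classical in
theorem trace_adjMatrix_sq {V : Type*} [Fintype V] {G : SimpleGraph V} {k : ℕ}
    (h : ∀ v, (G.neighborSet v).ncard = k) :
    (G.adjMatrix ℝ * G.adjMatrix ℝ).trace = Fintype.card V * k := by
  simp [trace, diag, adjMatrix_sq_apply, commonNeighbors_self, h, -adjMatrix_mul_apply,
    -mul_adjMatrix_apply]

open Classical in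
/-- Cospectral graphs, the first being regular and connected and the second regular, have
the same valency and there is a trace-preserving isomorphism of their full matrix algebras which
maps one adjacency matrix to the other and fixes the all-ones matrix. -/
theorem IsCospectral.exists_algEquiv {V W : Type*} [Fintype V] [Fintype W] {G : SimpleGraph V}
    {G' : SimpleGraph W} {k k' : ℕ} (hcosp : G'.IsCospectral G) (hG : G.Connected)
    (h : ∀ v, (G.neighborSet v).ncard = k) (h' : ∀ v, (G'.neighborSet v).ncard = k') :
    k' = k ∧ ∃ f : Matrix V V ℝ ≃ₐ[ℝ] Matrix W W ℝ, (∀ M, (f M).trace = M.trace) ∧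
      f (G.adjMatrix ℝ) = G'.adjMatrix ℝ ∧ f (allOnes V) = allOnes W := by
  obtain ⟨f, hf, hA⟩ := (isHermitian_adjMatrix (R := ℝ) G).exists_algEquiv_of_roots_charpoly_eq
    (isHermitian_adjMatrix (R := ℝ) G') (Eq.symm hcosp)
  have hcard : (Fintype.card W : ℝ) = Fintype.card V := by
    have := hf 1
    rwa [map_one, trace_one, trace_one] at this
  obtain ⟨v₀⟩ := hG.nonempty
  have hpos : (0 : ℝ) < Fintype.card V := by
    exact_mod_cast Fintype.card_pos_iff.2 ⟨v₀⟩
  have hk : k' = k := by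
    have := hf (G.adjMatrix ℝ * G.adjMatrix ℝ)
    rw [map_mul, hA, trace_adjMatrix_sq h, trace_adjMatrix_sq h', hcard] at this
    exact_mod_cast mul_left_cancel₀ hpos.ne' this
  refine ⟨hk, f, hf, hA, ?_⟩
  subst hk
  set N := f.symm (allOnes W) with hN
  have hfN : f N = allOnes W := by simp [hN]
  have h1 : G.adjMatrix ℝ * N = (k' : ℝ) • N := f.injective <| by
    rw [map_mul, map_smul, hA, hfN, adjMatrix_mul_allOnes h']
  have h2 : N * G.adjMatrix ℝ = (k' : ℝ) • N := f.injective <| by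
    rw [map_mul, map_smul, hA, hfN, allOnes_mul_adjMatrix h']
  have h2' : G.adjMatrix ℝ * Nᵀ = (k' : ℝ) • Nᵀ := by
    have := congrArg transpose h2
    rwa [transpose_mul, transpose_adjMatrix, transpose_smul] at this
  -- The preimage `N` of `J` satisfies `AN = kN = NA`, so its columns and rows are constant and it
  -- is a multiple of `J`; the trace then determines the scalar.
  have hc : N = N v₀ v₀ • allOnes V := by
    ext v w
    have e1 := hG.apply_eq_of_adjMatrix_mul_eq h h1 v v₀ w
    have e2 := hG.apply_eq_of_adjMatrix_mul_eq h h2' w v₀ v₀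
    rw [transpose_apply, transpose_apply] at e2
    simp [e1, e2]
  have htr := hf N
  rw [hfN, hc, trace_smul] at htr
  simp only [trace, diag, allOnes_apply, Finset.sum_const, Finset.card_univ, nsmul_eq_mul,
    mul_one, smul_eq_mul, hcard] at htr
  have hone : N v₀ v₀ = 1 := by
    have : (N v₀ v₀ - 1) * (Fintype.card V : ℝ) = 0 := by linarith
    rcases mul_eq_zero.1 this with h | h
    · linarith
    · exact absurd h hpos.ne'
  rw [hone, one_smul] at hc
  rw [← hc, hfN]

open Classical in
/-- A graph whose adjacency matrix `H` satisfies `H² ∈ ⟨I, H, J⟩` is strongly regular. -/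
theorem isStronglyRegular_of_adjMatrix_sq {V : Type*} [Fintype V] {H : SimpleGraph V}
    (htop : H ≠ ⊤) (hbot : H ≠ ⊥) {p q r : ℝ}
    (h : H.adjMatrix ℝ * H.adjMatrix ℝ = p • 1 + q • H.adjMatrix ℝ + r • allOnes V) :
    H.IsStronglyRegular := by
  have key : ∀ v w, ((H.commonNeighbors v w).ncard : ℝ) =
      p * (1 : Matrix V V ℝ) v w + q * H.adjMatrix ℝ v w + r := fun v w => by
    rw [← adjMatrix_sq_apply, h]
    simp
  obtain ⟨x, y, hxy⟩ := ne_bot_iff_exists_adj.1 hbot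
  obtain ⟨z, w, hzw, hn⟩ := ne_top_iff_exists_not_adj.1 htop
  have card_eq : ∀ v w, Fintype.card (H.commonNeighbors v w) = (H.commonNeighbors v w).ncard :=
    fun v w => by rw [Set.ncard_eq_toFinset_card', Set.toFinset_card]
  refine ⟨htop, hbot, Fintype.card V, H.degree x, (H.commonNeighbors x y).ncard,
    (H.commonNeighbors z w).ncard, rfl, fun v => ?_, fun v u hvu => ?_, fun v u hvu hn' => ?_⟩
  · rw [degree_eq_ncard, degree_eq_ncard, ← commonNeighbors_self, ← commonNeighbors_self]
    have := (key v v).trans (by simpa using (key x x).symm)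
    exact_mod_cast this
  · rw [card_eq]
    have := key v u
    have h2 := key x y
    simp only [one_apply_ne hvu.ne, one_apply_ne hxy.ne, adjMatrix_apply, hvu, hxy] at this h2
    exact_mod_cast this.trans h2.symm
  · rw [card_eq]
    have := key v u
    have h2 := key z w
    simp only [one_apply_ne hvu, one_apply_ne hzw, adjMatrix_apply, hn, hn'] at this h2
    exact_mod_cast this.trans h2.symm

theorem IsStronglyRegular.compl {V : Type*} [Fintype V] {H : SimpleGraph V}
    (h : H.IsStronglyRegular) : Hᶜ.IsStronglyRegular := by
  classical
  obtain ⟨htop, hbot, n, k, l, m, hs⟩ := h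
  refine ⟨fun e => hbot (by rw [← compl_compl H, e, compl_top]),
    fun e => htop (by rw [← compl_compl H, e, compl_bot]), n, n - k - 1,
    n - (2 * k - m) - 2, n - (2 * k - l), ?_⟩
  convert hs.compl

open Classical in
theorem IsStronglyRegular.adjMatrix_sq {V : Type*} [Fintype V] {H : SimpleGraph V}
    (h : H.IsStronglyRegular) : ∃ p q r : ℝ,
    H.adjMatrix ℝ * H.adjMatrix ℝ = p • 1 + q • H.adjMatrix ℝ + r • allOnes V := by
  obtain ⟨-, -, n, k, l, m, hs⟩ := h
  refine ⟨k - m, l - m, m, ?_⟩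
  rw [← sq, hs.matrix_eq]
  ext v w
  simp only [Matrix.add_apply, Matrix.smul_apply, allOnes_apply, adjMatrix_apply, compl_adj]
  by_cases hvw : v = w
  · subst hvw; simp
  · by_cases ha : H.Adj v w <;> simp [hvw, ha]

theorem childA_eq_compl {V : Type*} [Fintype V] {G : SimpleGraph V} {n k b a : ℕ}
    (h : G.IsDeza n k b a) (hba : b ≠ a) : G.childA a = (G.childB b a)ᶜ := by
  ext v w
  rw [compl_adj]
  change v ≠ w ∧ _ = a ↔ v ≠ w ∧ ¬ (b ≠ a ∧ v ≠ w ∧ _ = b)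
  refine ⟨fun ⟨h1, h2⟩ => ⟨h1, fun h3 => hba (h3.2.2 ▸ h2)⟩, fun ⟨h1, h2⟩ => ⟨h1, ?_⟩⟩
  exact (h.common v w h1).resolve_left fun h3 => h2 ⟨hba, h1, h3⟩

theorem childB_ne_bot {V : Type*} [Fintype V] {G : SimpleGraph V} {n k b a : ℕ}
    (h : G.IsDeza n k b a) (hba : b ≠ a) : G.childB b a ≠ ⊥ := by
  obtain ⟨v, w, hvw, hb⟩ := h.exists_b
  exact ne_bot_iff_exists_adj.2 ⟨v, w, hba, hvw, hb⟩

theorem childB_ne_top {V : Type*} [Fintype V] {G : SimpleGraph V} {n k b a : ℕ}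
    (h : G.IsDeza n k b a) (hba : b ≠ a) : G.childB b a ≠ ⊤ := by
  obtain ⟨v, w, hvw, hb⟩ := h.exists_a
  exact ne_top_iff_exists_not_adj.2 ⟨v, w, hvw, fun h3 => hba (h3.2.2 ▸ hb)⟩

open Classical in
/-- `A² = (k-a) I + a J + (b-a) B`. -/
theorem IsDeza.adjMatrix_sq {V : Type*} [Fintype V] {G : SimpleGraph V} {n k b a : ℕ}
    (h : G.IsDeza n k b a) : G.adjMatrix ℝ * G.adjMatrix ℝ =
      ((k : ℝ) - a) • 1 + (a : ℝ) • allOnes V + ((b : ℝ) - a) • (G.childB b a).adjMatrix ℝ := by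
  ext v w
  rw [adjMatrix_sq_apply]
  simp only [Matrix.add_apply, Matrix.smul_apply, allOnes_apply, smul_eq_mul, adjMatrix_apply]
  by_cases hvw : v = w
  · subst hvw
    simp [commonNeighbors_self, h.regular]
  · rw [one_apply_ne hvw]
    by_cases hb : (G.commonNeighbors v w).ncard = b
    · by_cases hba : b = a
      · simp [hb, hba]
      · rw [if_pos (show (G.childB b a).Adj v w from ⟨hba, hvw, hb⟩), hb]; ring
    · have ha := (h.common v w hvw).resolve_left hb
      rw [if_neg (fun h : (G.childB b a).Adj v w => hb h.2.2), ha]; ring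

end SimpleGraph
-- Transfer of the strongly Deza property and of the parameters.
namespace SimpleGraph

/-- The constant row and column sums `c` collapse every cross term with `J` to a multiple of `J`, so
computing `(zY)² = (X - xI - yJ)²` in two ways gives the coefficients. Used in both directions: from
`B` to `A²` in `G`, and from `A'²` to `B'` in `G'`. -/
theorem _root_.Matrix.mul_self_eq_of_eq_add_smul {V : Type*} [Fintype V] [DecidableEq V]
    {X Y : Matrix V V ℝ} {x y z p q r c : ℝ} (hX : X = x • 1 + y • allOnes V + z • Y)
    (hY : Y * Y = p • 1 + q • Y + r • allOnes V) (h1 : X * allOnes V = c • allOnes V)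
    (h2 : allOnes V * X = c • allOnes V) :
    ∃ p' q' r' : ℝ, X * X = p' • 1 + q' • X + r' • allOnes V := by
  refine ⟨z ^ 2 * p - q * z * x - x ^ 2, q * z + 2 * x,
    z ^ 2 * r - q * z * y + 2 * y * c - 2 * x * y - y ^ 2 * Fintype.card V, ?_⟩
  have e1 : z • Y = X - x • 1 - y • allOnes V := by rw [hX]; abel
  have e2 : (z • Y) * (z • Y) = (z ^ 2 * p) • 1 + (q * z) • (z • Y) + (z ^ 2 * r) • allOnes V := by
    rw [smul_mul_smul_comm, hY]
    module
  have e3 : (z • Y) * (z • Y) = X * X - (2 * x) • X - (2 * y * c) • allOnes V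
      + (x ^ 2) • 1 + (2 * x * y) • allOnes V + (y ^ 2 * Fintype.card V) • allOnes V := by
    rw [e1]
    simp only [sub_mul, mul_sub, smul_mul_assoc, mul_smul_comm, h1, h2, allOnes_mul_allOnes,
      one_mul, mul_one]
    module
  have e4 : X * X = (z • Y) * (z • Y) + (2 * x) • X + (2 * y * c) • allOnes V
      - (x ^ 2) • 1 - (2 * x * y) • allOnes V - (y ^ 2 * Fintype.card V) • allOnes V := by
    rw [e3]; abel
  rw [e4, e2, e1]
  module

open Classical in
theorem adjMatrix_sq_mul_allOnes {V : Type*} [Fintype V] {G : SimpleGraph V} {k : ℕ}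
    (h : ∀ v, (G.neighborSet v).ncard = k) :
    G.adjMatrix ℝ * G.adjMatrix ℝ * allOnes V = ((k : ℝ) * k) • allOnes V := by
  rw [mul_assoc, adjMatrix_mul_allOnes h, mul_smul_comm, adjMatrix_mul_allOnes h, smul_smul]

open Classical in
theorem allOnes_mul_adjMatrix_sq {V : Type*} [Fintype V] {G : SimpleGraph V} {k : ℕ}
    (h : ∀ v, (G.neighborSet v).ncard = k) :
    allOnes V * (G.adjMatrix ℝ * G.adjMatrix ℝ) = ((k : ℝ) * k) • allOnes V := by
  rw [← mul_assoc, allOnes_mul_adjMatrix h, smul_mul_assoc, allOnes_mul_adjMatrix h, smul_smul]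

theorem IsStronglyDeza.b_ne_a {V : Type*} [Fintype V] {G : SimpleGraph V} {n k b a : ℕ}
    (h : G.IsStronglyDeza n k b a) : b ≠ a := by
  obtain ⟨v, w, hvw⟩ := ne_bot_iff_exists_adj.1 h.childB_srg.2.1
  exact hvw.1

/-- A Deza graph cospectral with a connected strongly Deza graph is strongly Deza. -/
theorem IsStronglyDeza.of_isCospectral {V W : Type*} [Fintype V] [Fintype W] {G : SimpleGraph V}
    {G' : SimpleGraph W} {n k b a n' k' b' a' : ℕ} (hG : G.Connected)
    (h : G.IsStronglyDeza n k b a) (h' : G'.IsDeza n' k' b' a') (hcosp : G'.IsCospectral G) :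
    b' ≠ a' ∧ G'.IsStronglyDeza n' k' b' a' := by
  classical
  obtain ⟨hk, f, -, hA, hJ⟩ := hcosp.exists_algEquiv hG h.isDeza.regular h'.regular
  subst hk
  have hS : f (G.adjMatrix ℝ * G.adjMatrix ℝ) = G'.adjMatrix ℝ * G'.adjMatrix ℝ := by
    rw [map_mul, hA]
  -- If `b' = a'`, then `A'²`, and hence `A²`, is a combination of `I` and `J`, so all
  -- common-neighbour counts in `G` coincide.
  have hba' : b' ≠ a' := by
    intro hba
    have e := h'.adjMatrix_sq
    rw [hba, sub_self, zero_smul, add_zero, ← hS] at e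
    have e2 : G.adjMatrix ℝ * G.adjMatrix ℝ = ((k' : ℝ) - a') • 1 + (a' : ℝ) • allOnes V :=
      f.injective <| by rw [e, map_add, map_smul, map_smul, map_one, hJ]
    have e3 : ∀ v w, v ≠ w → (G.commonNeighbors v w).ncard = a' := fun v w hvw => by
      have := congrFun (congrFun e2 v) w
      rw [adjMatrix_sq_apply] at this
      simp only [Matrix.add_apply, Matrix.smul_apply, one_apply_ne hvw, allOnes_apply,
        smul_eq_mul, mul_zero, mul_one, zero_add] at this
      exact_mod_cast this
    obtain ⟨v, w, hvw, hb⟩ := h.isDeza.exists_b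
    obtain ⟨x, y, hxy, ha⟩ := h.isDeza.exists_a
    exact h.b_ne_a (by rw [← hb, ← ha, e3 v w hvw, e3 x y hxy])
  refine ⟨hba', ?_⟩
  obtain ⟨p, q, r, hB⟩ := h.childB_srg.adjMatrix_sq
  obtain ⟨p₁, q₁, r₁, h₁⟩ := mul_self_eq_of_eq_add_smul h.isDeza.adjMatrix_sq hB
    (adjMatrix_sq_mul_allOnes h.isDeza.regular) (allOnes_mul_adjMatrix_sq h.isDeza.regular)
  have h₂ := congrArg f h₁
  rw [map_mul, hS, map_add, map_add, map_smul, map_smul, map_smul, map_one, hS, hJ] at h₂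
  have hz : (b' : ℝ) - a' ≠ 0 := sub_ne_zero.2 (by exact_mod_cast hba')
  set z := (b' : ℝ) - a'
  have hB' : (G'.childB b' a').adjMatrix ℝ = (-(z⁻¹ * (k' - a'))) • 1 + (-(z⁻¹ * a')) • allOnes W
      + z⁻¹ • (G'.adjMatrix ℝ * G'.adjMatrix ℝ) := by
    have e := h'.adjMatrix_sq
    rw [e, smul_add, smul_add, smul_smul z⁻¹ z, inv_mul_cancel₀ hz]
    module
  have hsrg : (G'.childB b' a').IsStronglyRegular := by
    -- Here `c` is the row sum of `B'`, read off from `hB'` with `A'²` having row sums `k'²`.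
    obtain ⟨p₃, q₃, r₃, h₃⟩ := mul_self_eq_of_eq_add_smul hB' h₂
      (c := -(z⁻¹ * (k' - a')) + -(z⁻¹ * a') * Fintype.card W + z⁻¹ * (k' * k'))
      (by
        conv_lhs => rw [hB']
        rw [add_mul, add_mul, smul_mul_assoc, smul_mul_assoc, smul_mul_assoc,
          adjMatrix_sq_mul_allOnes h'.regular, allOnes_mul_allOnes, one_mul]
        module)
      (by
        conv_lhs => rw [hB']
        rw [mul_add, mul_add, mul_smul_comm, mul_smul_comm, mul_smul_comm,
          allOnes_mul_adjMatrix_sq h'.regular, allOnes_mul_allOnes, mul_one]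
        module)
    exact isStronglyRegular_of_adjMatrix_sq (childB_ne_top h' hba') (childB_ne_bot h' hba') h₃
  exact ⟨h', childA_eq_compl h' hba' ▸ hsrg.compl, hsrg⟩

-- Turns a spectral invariant into a sum over pairs of vertices. In a Deza graph with `a = 0`,
-- taking `t = b` kills every off-diagonal term.
open Classical in
theorem trace_adjMatrix_sq_mul_sub {V : Type*} [Fintype V] {G : SimpleGraph V} {k : ℕ}
    (h : ∀ v, (G.neighborSet v).ncard = k) (t : ℝ) :
    (G.adjMatrix ℝ * G.adjMatrix ℝ * (G.adjMatrix ℝ * G.adjMatrix ℝ - t • allOnes V)).trace =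
      Fintype.card V * (k * (k - t)) + ∑ v, ∑ w, if v = w then 0 else
        ((G.commonNeighbors v w).ncard : ℝ) * ((G.commonNeighbors v w).ncard - t) := by
  have key : ∀ v w, (if v = w then (k : ℝ) * (k - t) else 0) + (if v = w then 0 else
        ((G.commonNeighbors v w).ncard : ℝ) * ((G.commonNeighbors v w).ncard - t)) =
      (G.adjMatrix ℝ * G.adjMatrix ℝ) v w *
        (G.adjMatrix ℝ * G.adjMatrix ℝ - t • allOnes V) w v := fun v w => by
    rw [Matrix.sub_apply, Matrix.smul_apply, adjMatrix_sq_apply, adjMatrix_sq_apply,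
      commonNeighbors_symm G w v]
    by_cases hvw : v = w
    · subst hvw
      simp [commonNeighbors_self, h]
    · simp [hvw]
  simp only [trace, diag]
  calc _ = ∑ v, ∑ w, ((if v = w then (k : ℝ) * (k - t) else 0) + (if v = w then 0 else
        ((G.commonNeighbors v w).ncard : ℝ) * ((G.commonNeighbors v w).ncard - t))) := by
        refine Finset.sum_congr rfl fun v _ => ?_
        rw [mul_apply]
        exact Finset.sum_congr rfl fun w _ => (key v w).symm
    _ = _ := by
        simp only [Finset.sum_add_distrib]
        simp

/-- Cospectral Deza graphs, the first being connected with `a = 0 < b`, which agree in one of the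
parameters `a` and `b` agree in both. -/
theorem IsDeza.params_eq_of_isCospectral {V W : Type*} [Fintype V] [Fintype W] {G : SimpleGraph V}
    {G' : SimpleGraph W} {n k b n' k' b' a' : ℕ} (hG : G.Connected)
    (h : G.IsDeza n k b 0) (h' : G'.IsDeza n' k' b' a') (hcosp : G'.IsCospectral G)
    (hba' : b' ≠ a') (hor : a' = 0 ∨ b' = b) : a' = 0 ∧ b' = b := by
  classical
  obtain ⟨hk, f, htr, hA, hJ⟩ := hcosp.exists_algEquiv hG h.regular h'.regular
  subst hk
  have hcard : (Fintype.card W : ℝ) = Fintype.card V := by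
    have := htr 1
    rwa [map_one, trace_one, trace_one] at this
  have e := htr (G.adjMatrix ℝ * G.adjMatrix ℝ *
    (G.adjMatrix ℝ * G.adjMatrix ℝ - (b : ℝ) • allOnes V))
  simp only [map_mul, map_sub, map_smul, hA, hJ] at e
  rw [trace_adjMatrix_sq_mul_sub h.regular, trace_adjMatrix_sq_mul_sub h'.regular, hcard] at e
  have e0 : ∑ v, ∑ w, (if v = w then (0 : ℝ) else
      ((G.commonNeighbors v w).ncard : ℝ) * ((G.commonNeighbors v w).ncard - b)) = 0 := by
    refine Finset.sum_eq_zero fun v _ => Finset.sum_eq_zero fun w _ => ?_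
    split_ifs with hvw
    · rfl
    · rcases h.common v w hvw with h | h <;> simp [h]
  rw [e0] at e
  have e1 := add_left_cancel e
  have hlt : a' < b' := lt_of_le_of_ne h'.le hba'.symm
  -- What remains is that the counts `λ` of `G'` satisfy `∑ λ(λ - b) = 0`. If `a' = 0`, the nonzero
  -- terms can only be copies of `b'(b' - b)`. If `b' = b`, no term is positive, so each vanishes,
  -- including `a'(a' - b')`.
  rcases hor with rfl | rfl
  · refine ⟨rfl, ?_⟩
    obtain ⟨x, y, hxy, hb⟩ := h'.exists_b
    have e2 : ∀ v w, (if v = w then (0 : ℝ) else ((G'.commonNeighbors v w).ncard : ℝ) *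
        ((G'.commonNeighbors v w).ncard - b)) = (if v = w ∨ (G'.commonNeighbors v w).ncard = 0
          then 0 else 1) * ((b' : ℝ) * (b' - b)) := fun v w => by
      by_cases hvw : v = w
      · simp [hvw]
      · rcases h'.common v w hvw with h | h
        · simp [hvw, h, hba']
        · simp [hvw, h]
    simp only [e2, ← Finset.sum_mul] at e1
    rcases mul_eq_zero.1 e1 with h0 | h0
    · rw [Finset.sum_eq_zero_iff_of_nonneg
        (fun v _ => Finset.sum_nonneg fun w _ => by split_ifs <;> norm_num)] at h0
      have h1 := h0 x (Finset.mem_univ _)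
      rw [Finset.sum_eq_zero_iff_of_nonneg (fun w _ => by split_ifs <;> norm_num)] at h1
      have h2 := h1 y (Finset.mem_univ _)
      simp [hxy, hb, hba'] at h2
    · rcases mul_eq_zero.1 h0 with h0 | h0
      · exact absurd (by exact_mod_cast h0) hba'
      · exact_mod_cast sub_eq_zero.1 h0
  · refine ⟨?_, rfl⟩
    obtain ⟨x, y, hxy, ha⟩ := h'.exists_a
    have hneg : ∀ v w, (if v = w then (0 : ℝ) else ((G'.commonNeighbors v w).ncard : ℝ) *
        ((G'.commonNeighbors v w).ncard - b')) ≤ 0 := fun v w => by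
      split_ifs with hvw
      · rfl
      · refine mul_nonpos_of_nonneg_of_nonpos (Nat.cast_nonneg _) (sub_nonpos.2 ?_)
        rcases h'.common v w hvw with h | h <;> rw [h]
        exact_mod_cast hlt.le
    rw [Finset.sum_eq_zero_iff_of_nonpos
        (fun v _ => Finset.sum_nonpos fun w _ => hneg v w)] at e1
    have h1 := e1 x (Finset.mem_univ _)
    rw [Finset.sum_eq_zero_iff_of_nonpos (fun w _ => hneg x w)] at h1
    have h2 := h1 y (Finset.mem_univ _)
    rw [if_neg hxy, ha] at h2
    rcases mul_eq_zero.1 h2 with h0 | h0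
    · exact_mod_cast h0
    · exact absurd (by exact_mod_cast (sub_eq_zero.1 h0).symm) hba'

open Classical in
theorem IsDeza.adjMatrix_childA {V : Type*} [Fintype V] {G : SimpleGraph V} {n k b a : ℕ}
    (h : G.IsDeza n k b a) (hba : b ≠ a) :
    (G.childA a).adjMatrix ℝ = allOnes V - 1 - (G.childB b a).adjMatrix ℝ := by
  ext v w
  simp only [Matrix.sub_apply, allOnes_apply, adjMatrix_apply, childA_eq_compl h hba, compl_adj]
  by_cases hvw : v = w
  · subst hvw; simp
  · by_cases hB : (G.childB b a).Adj v w <;> simp [hvw, hB]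

end SimpleGraph
-- Recognizing distance-regular graphs of diameter 3.
namespace SimpleGraph

/-- The neighbours of `y` are at distance `i + 1`, `i` or `i - 1` from `x`, where `i = d(x, y)`. -/
theorem Connected.ncard_add_ncard_add_ncard {V : Type*} [Fintype V] {G : SimpleGraph V}
    (hG : G.Connected) {i : ℕ} {x y : V} (h : G.dist x y = i) :
    {z | G.Adj y z ∧ G.dist x z = i + 1}.ncard + {z | G.Adj y z ∧ G.dist x z = i}.ncard +
      {z | G.Adj y z ∧ G.dist x z + 1 = i}.ncard = (G.neighborSet y).ncard := by
  rw [← Set.ncard_union_eq, ← Set.ncard_union_eq]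
  · congr 1
    ext z
    simp only [Set.mem_union, Set.mem_ofPred_eq, mem_neighborSet]
    refine ⟨by tauto, fun hz => ?_⟩
    have h1 := hG.dist_triangle (u := x) (v := y) (w := z)
    have h2 := hG.dist_triangle (u := x) (v := z) (w := y)
    rw [dist_eq_one_iff_adj.2 hz] at h1
    rw [dist_eq_one_iff_adj.2 hz.symm] at h2
    have : G.dist x z = i + 1 ∨ G.dist x z = i ∨ G.dist x z + 1 = i := by omega
    tauto
  · rw [Set.disjoint_left]
    rintro z (⟨-, h1⟩ | ⟨-, h1⟩) ⟨-, h2⟩ <;> omega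
  · rw [Set.disjoint_left]
    rintro z ⟨-, h1⟩ ⟨-, h2⟩
    omega

theorem exists_adj_adj_of_dist_eq_two {V : Type*} {G : SimpleGraph V} {x y : V}
    (h : G.dist x y = 2) : ∃ z, G.Adj x z ∧ G.Adj z y := by
  obtain ⟨p, hp⟩ := exists_walk_of_dist_ne_zero (h ▸ two_ne_zero)
  rw [h] at hp
  match p, hp with
  | .cons h1 (.cons h2 .nil), _ => exact ⟨_, h1, h2⟩

theorem exists_adj_adj_adj_of_dist_eq_three {V : Type*} {G : SimpleGraph V} {x y : V}
    (h : G.dist x y = 3) : ∃ z w, G.Adj x z ∧ G.Adj z w ∧ G.Adj w y := by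
  obtain ⟨p, hp⟩ := exists_walk_of_dist_ne_zero (h ▸ three_ne_zero)
  rw [h] at hp
  match p, hp with
  | .cons h1 (.cons h2 (.cons h3 .nil)), _ => exact ⟨_, _, h1, h2, h3⟩

theorem ncard_commonNeighbors_eq_zero_iff {V : Type*} [Fintype V] {G : SimpleGraph V} {x y : V} :
    (G.commonNeighbors x y).ncard = 0 ↔ ∀ z, G.Adj x z → ¬ G.Adj z y := by
  rw [Set.ncard_eq_zero, Set.eq_empty_iff_forall_notMem]
  simp only [mem_commonNeighbors, not_and, G.adj_comm y]

open Classical in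
/-- If distinct vertices of a `k`-regular graph have `m` or `0` common neighbours and the graph `P`
of the pairs without common neighbours satisfies `AP = β(J - I - A - P) + αP` with `α < k`,
then the graph is distance-regular of diameter 3. -/
theorem isDistanceRegular_three {V : Type*} [Fintype V] {G : SimpleGraph V} {k m α β : ℕ}
    {ia ib ic : ℕ → ℕ} (hreg : ∀ v, (G.neighborSet v).ncard = k) (hα : α < k)
    (hcomm : ∀ v w, v ≠ w →
      (G.commonNeighbors v w).ncard = m ∨ (G.commonNeighbors v w).ncard = 0)
    (hex : ∃ v w, (G.childA 0).Adj v w)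
    (hmul : G.adjMatrix ℝ * (G.childA 0).adjMatrix ℝ =
      (β : ℝ) • (allOnes V - 1 - G.adjMatrix ℝ - (G.childA 0).adjMatrix ℝ) +
        (α : ℝ) • (G.childA 0).adjMatrix ℝ)
    (ha : ia 0 = 0 ∧ ia 1 = m ∧ ia 3 = α) (hb : ib 2 = β) (hc : ic 0 = 0 ∧ ic 1 = 1 ∧ ic 2 = m)
    (hsum : ∀ i ≤ 3, ib i + ia i + ic i = k) (hb3 : ib 3 = 0) :
    G.IsDistanceRegular 3 ia ib ic := by
  have hP : ∀ v w, (G.childA 0).Adj v w ↔ v ≠ w ∧ (G.commonNeighbors v w).ncard = 0 :=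
    fun v w => Iff.rfl
  have hent : ∀ v w, ({z | G.Adj v z ∧ (G.childA 0).Adj z w}.ncard : ℝ) =
      β * (1 - (1 : Matrix V V ℝ) v w - G.adjMatrix ℝ v w - (G.childA 0).adjMatrix ℝ v w) +
        α * (G.childA 0).adjMatrix ℝ v w := fun v w => by
    rw [← adjMatrix_mul_adjMatrix_apply, hmul]
    rfl
  -- The right-hand side of `hmul` has zero diagonal, so no edge of `G` is an edge of `P`.
  have hPadj : ∀ v w, (G.childA 0).Adj v w → ¬ G.Adj v w := fun v w h hvw => by
    have := hent v v
    simp only [one_apply_eq, adjMatrix_apply, SimpleGraph.irrefl, if_false] at this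
    have h0 : {z | G.Adj v z ∧ (G.childA 0).Adj z v}.ncard = 0 := by
      have : ({z | G.Adj v z ∧ (G.childA 0).Adj z v}.ncard : ℝ) = 0 := by rw [this]; ring
      exact_mod_cast this
    rw [Set.ncard_eq_zero] at h0
    exact (h0 ▸ Set.notMem_empty w : w ∉ {z | G.Adj v z ∧ (G.childA 0).Adj z v}) ⟨hvw, h.symm⟩
  have hPcount : ∀ v w, (G.childA 0).Adj v w →
      {z | G.Adj v z ∧ (G.childA 0).Adj z w}.ncard = α := fun v w h => by
    have := hent v w
    simp only [one_apply_ne h.ne, adjMatrix_apply, h, hPadj v w h, if_true, if_false] at this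
    have : ({z | G.Adj v z ∧ (G.childA 0).Adj z w}.ncard : ℝ) = α := by rw [this]; ring
    exact_mod_cast this
  have hncount : ∀ v w, v ≠ w → ¬ G.Adj v w → ¬ (G.childA 0).Adj v w →
      {z | G.Adj v z ∧ (G.childA 0).Adj z w}.ncard = β := fun v w h1 h2 h3 => by
    have := hent v w
    simp only [one_apply_ne h1, adjMatrix_apply, h2, h3, if_false] at this
    have : ({z | G.Adj v z ∧ (G.childA 0).Adj z w}.ncard : ℝ) = β := by rw [this]; ring
    exact_mod_cast this
  have hpath2 : ∀ v w, v ≠ w → ¬ (G.childA 0).Adj v w → ∃ z, G.Adj v z ∧ G.Adj z w :=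
    fun v w h1 h2 => by
      by_contra! h3
      exact h2 ⟨h1, ncard_commonNeighbors_eq_zero_iff.2 h3⟩
  -- As `α < k`, some neighbour of `v` is not `P`-adjacent to `w`, and so is joined to `w` by a
  -- 2-path.
  have hpath3 : ∀ v w, (G.childA 0).Adj v w → ∃ z u, G.Adj v z ∧ G.Adj z u ∧ G.Adj u w :=
    fun v w h => by
      by_contra! hno
      have : {z | G.Adj v z ∧ (G.childA 0).Adj z w} = G.neighborSet v := by
        ext z
        simp only [Set.mem_ofPred_eq, mem_neighborSet]
        refine ⟨And.left, fun hz => ⟨hz, ?_⟩⟩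
        by_contra hPz
        have hzw : z ≠ w := fun e => hPadj v w h (e ▸ hz)
        obtain ⟨u, h1, h2⟩ := hpath2 z w hzw hPz
        exact hno z u hz h1 h2
      have h1 := hPcount v w h
      rw [this, hreg] at h1
      omega
  have hconn : G.Connected := by
    obtain ⟨v₀, -, -⟩ := hex
    have : Nonempty V := ⟨v₀⟩
    refine ⟨fun v w => ?_⟩
    by_cases hvw : v = w
    · subst hvw; exact .rfl
    by_cases h : (G.childA 0).Adj v w
    · obtain ⟨z, u, h1, h2, h3⟩ := hpath3 v w h
      exact (h1.reachable.trans h2.reachable).trans h3.reachable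
    · obtain ⟨z, h1, h2⟩ := hpath2 v w hvw h
      exact h1.reachable.trans h2.reachable
  have hdist3 : ∀ v w, (G.childA 0).Adj v w → G.dist v w = 3 := fun v w h => by
    obtain ⟨z, u, h1, h2, h3⟩ := hpath3 v w h
    have hle : G.dist v w ≤ 3 := dist_le (.cons h1 (.cons h2 (.cons h3 .nil)))
    have hlt := hconn.one_lt_dist_of_ne_of_not_adj h.ne (hPadj v w h)
    have hne : G.dist v w ≠ 2 := fun h2 => by
      obtain ⟨z, h3, h4⟩ := exists_adj_adj_of_dist_eq_two h2
      exact ncard_commonNeighbors_eq_zero_iff.1 h.2 z h3 h4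
    omega
  have hdist_le : ∀ v w, ¬ (G.childA 0).Adj v w → G.dist v w ≤ 2 := fun v w h => by
    by_cases hvw : v = w
    · subst hvw; simp
    · obtain ⟨z, h1, h2⟩ := hpath2 v w hvw h
      exact dist_le (.cons h1 (.cons h2 .nil))
  have hiff : ∀ v w, G.dist v w = 3 ↔ (G.childA 0).Adj v w := fun v w =>
    ⟨fun h => by_contra fun h' => by have := hdist_le v w h'; omega, hdist3 v w⟩
  have hle3 : ∀ v w, G.dist v w ≤ 3 := fun v w => by
    by_cases h : (G.childA 0).Adj v w
    · exact (hdist3 v w h).le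
    · exact (hdist_le v w h).trans (by norm_num)
  -- This yields `a₁` and `c₂` at once, since distances 1 and 2 are both outside `P`.
  have hsame : ∀ x y, x ≠ y → ¬ (G.childA 0).Adj x y →
      {z | G.Adj y z ∧ G.Adj x z}.ncard = m := fun x y h h' => by
    rw [← (hcomm y x h.symm).resolve_right fun h0 => h' ((hP x y).2
      ⟨h, by rw [commonNeighbors_symm]; exact h0⟩)]
    rfl
  have hpred : ∀ i ≤ 3, i ≠ 3 → ∀ x y, G.dist x y = i →
      {z | G.Adj y z ∧ G.dist x z + 1 = i}.ncard = ic i := by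
    intro i hi hi3 x y hxy
    obtain rfl | rfl | rfl : i = 0 ∨ i = 1 ∨ i = 2 := by omega
    · simp [hc.1]
    · rw [hc.2.1, Set.ncard_eq_one]
      refine ⟨x, ?_⟩
      ext z
      simp only [Set.mem_ofPred_eq, Set.mem_singleton_iff, Nat.add_eq_right, hconn.dist_eq_zero_iff]
      exact ⟨fun h => h.2.symm, fun h => ⟨h ▸ (dist_eq_one_iff_adj.1 hxy).symm, h.symm⟩⟩
    · rw [hc.2.2, ← hsame x y]
      · congr 1
        ext z
        simp [dist_eq_one_iff_adj]
      · rintro rfl; simp at hxy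
      · rw [← hiff]; omega
  have hsm : ∀ i ≤ 3, i ≠ 2 → ∀ x y, G.dist x y = i →
      {z | G.Adj y z ∧ G.dist x z = i}.ncard = ia i := by
    intro i hi hi3 x y hxy
    obtain rfl | rfl | rfl : i = 0 ∨ i = 1 ∨ i = 3 := by omega
    · rw [ha.1, Set.ncard_eq_zero, Set.eq_empty_iff_forall_notMem]
      rintro z ⟨h1, h2⟩
      rw [hconn.dist_eq_zero_iff] at hxy h2
      exact h1.ne (hxy.symm.trans h2)
    · rw [ha.2.1, ← hsame x y]
      · simp only [dist_eq_one_iff_adj]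
      · rintro rfl; simp at hxy
      · rw [← hiff]; omega
    · rw [ha.2.2, ← hPcount y x ((hiff x y).1 hxy).symm]
      simp only [hiff, (G.childA 0).adj_comm x]
  have hsc : ∀ i ≤ 3, 2 ≤ i → ∀ x y, G.dist x y = i →
      {z | G.Adj y z ∧ G.dist x z = i + 1}.ncard = ib i := by
    intro i hi hi2 x y hxy
    obtain rfl | rfl : i = 2 ∨ i = 3 := by omega
    · rw [hb, ← hncount y x]
      · simp only [hiff, (G.childA 0).adj_comm x]
      · rintro rfl; simp at hxy
      · intro h
        rw [dist_eq_one_iff_adj.2 h.symm] at hxy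
        omega
      · intro h
        rw [hdist3 _ _ h.symm] at hxy
        omega
    · rw [hb3, Set.ncard_eq_zero, Set.eq_empty_iff_forall_notMem]
      rintro z ⟨-, h2⟩
      have := hle3 x z
      omega
  -- The numbers not counted directly, `b₀`, `b₁`, `a₂` and `c₃`, follow from `bᵢ + aᵢ + cᵢ = k`.
  have htot : ∀ i ≤ 3, ∀ x y, G.dist x y = i → _ := fun i hi x y hxy =>
    ((hconn.ncard_add_ncard_add_ncard hxy).trans (hreg y)).trans (hsum i hi).symm
  refine ⟨hconn, ?_, fun i hi x y hxy => ?_, fun i hi x y hxy => ?_, fun i hi x y hxy => ?_⟩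
  · obtain ⟨x, y, hxy⟩ := hex
    have : Nonempty V := ⟨x⟩
    refine le_antisymm ?_ ?_
    · obtain ⟨u, v, huv⟩ := G.exists_dist_eq_diam
      exact huv ▸ hle3 u v
    · rw [← hdist3 x y hxy]
      exact dist_le_diam (connected_iff_ediam_ne_top.1 hconn)
  · by_cases h : 2 ≤ i
    · exact hsc i hi h x y hxy
    · have := htot i hi x y hxy
      rw [hpred i hi (by omega) x y hxy, hsm i hi (by omega) x y hxy] at this
      omega
  · by_cases h : i = 2
    · have := htot i hi x y hxy
      rw [hpred i hi (by omega) x y hxy, hsc i hi (by omega) x y hxy] at this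
      omega
    · exact hsm i hi h x y hxy
  · by_cases h : i = 3
    · have := htot i hi x y hxy
      rw [hsm i hi (by omega) x y hxy, hsc i hi (by omega) x y hxy] at this
      omega
    · exact hpred i hi h x y hxy

end SimpleGraph
-- Common neighbours in the given distance-regular graph.
namespace SimpleGraph

theorem IsDistanceRegular.dist_le {V : Type*} [Fintype V] {G : SimpleGraph V} {d : ℕ}
    {ia ib ic : ℕ → ℕ} (h : G.IsDistanceRegular d ia ib ic) (v w : V) : G.dist v w ≤ d := by
  have := h.connected.nonempty
  exact h.diam_eq ▸ dist_le_diam (connected_iff_ediam_ne_top.1 h.connected)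

theorem IsDistanceRegular.exists_dist_eq {V : Type*} {G : SimpleGraph V} {d : ℕ}
    {ia ib ic : ℕ → ℕ} (h : G.IsDistanceRegular d ia ib ic) : ∃ v w, G.dist v w = d := by
  have := h.connected.nonempty
  exact h.diam_eq ▸ G.exists_dist_eq_diam

/-- Numbers of common neighbours in a distance-regular graph of diameter 3 with `a₁ = c₂`. -/
theorem IsDistanceRegular.ncard_commonNeighbors {V : Type*} [Fintype V] {G : SimpleGraph V}
    {ia ib ic : ℕ → ℕ} (h : G.IsDistanceRegular 3 ia ib ic) (hac : ia 1 = ic 2) {v w : V}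
    (hvw : v ≠ w) :
    (G.commonNeighbors v w).ncard = if G.dist v w = 3 then 0 else ic 2 := by
  have h0 := h.connected.pos_dist_of_ne hvw
  have h3 := h.dist_le v w
  have hset : G.commonNeighbors v w = {z | G.Adj w z ∧ G.dist v z = 1} := by
    ext z
    simp [mem_commonNeighbors, and_comm, dist_eq_one_iff_adj]
  obtain h1 | h1 | h1 : G.dist v w = 1 ∨ G.dist v w = 2 ∨ G.dist v w = 3 := by omega
  · rw [hset, h.card_same 1 (by norm_num) v w h1, hac, if_neg (by omega)]
  · rw [if_neg (by omega), ← h.card_pred 2 (by norm_num) v w h1, hset]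
    simp
  · rw [if_pos h1, ncard_commonNeighbors_eq_zero_iff]
    intro z h4 h5
    have := SimpleGraph.dist_le (Walk.cons h4 (Walk.cons h5 Walk.nil))
    rw [h1] at this
    simp at this

end SimpleGraph

/-! ### The main theorem. -/

open SimpleGraph in
theorem mainTheorem9 {V W : Type*} [Fintype V] [Fintype W]
    (G : SimpleGraph V) (G' : SimpleGraph W)
    (ia ib ic : ℕ → ℕ) (n k b a n' k' b' a' : ℕ)
    (hdr : G.IsDistanceRegular 3 ia ib ic) (hac : ia 1 = ic 2)
    (hsd : G.IsStronglyDeza n k b a)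
    (hcosp : G'.IsCospectral G)
    (hdeza : G'.IsDeza n' k' b' a') :
    G'.IsStronglyDeza n' k' b' a' ∧
      (G'.IsDistanceRegular 3 ia ib ic ∨ (a' ≠ a ∧ b' ≠ b)) := by
  classical
  have hconn := hdr.connected
  have hreg := hsd.isDeza.regular
  obtain ⟨hba', hsd'⟩ := hsd.of_isCospectral hconn hdeza hcosp
  refine ⟨hsd', ?_⟩
  obtain ⟨x, y, hxy⟩ := hdr.exists_dist_eq
  -- The vertices `x`, `u`, `v`, `y` of a geodesic realize all distances 0 to 3 from `x`; they show
  -- that `c₂` and `c₃` are positive.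
  obtain ⟨u, v, hxu, huv, hvy⟩ := exists_adj_adj_adj_of_dist_eq_three hxy
  have hxv : G.dist x v = 2 := by
    have h1 : G.dist x v ≤ 2 := dist_le (.cons hxu (.cons huv .nil))
    have h2 := hconn.dist_triangle (u := x) (v := v) (w := y)
    rw [dist_eq_one_iff_adj.2 hvy, hxy] at h2
    omega
  have hc2 : ic 2 ≠ 0 := by
    rw [← hdr.card_pred 2 (by norm_num) x v hxv]
    exact Set.ncard_ne_zero_of_mem (a := u) ⟨huv.symm, by rw [dist_eq_one_iff_adj.2 hxu]⟩
  have hc3 : ic 3 ≠ 0 := by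
    rw [← hdr.card_pred 3 le_rfl x y hxy]
    exact Set.ncard_ne_zero_of_mem (a := v) ⟨hvy.symm, by rw [hxv]⟩
  have hcom := fun {v w : V} (hvw : v ≠ w) => hdr.ncard_commonNeighbors hac hvw
  have hxy' : x ≠ y := by rintro rfl; simp at hxy
  have hxv' : x ≠ v := by rintro rfl; simp at hxv
  have h3 := hsd.isDeza.common x y hxy'
  have h2 := hsd.isDeza.common x v hxv'
  rw [hcom hxy', if_pos hxy] at h3
  rw [hcom hxv', if_neg (by omega)] at h2
  have hle := hsd.isDeza.le
  -- Both 0 (at distance 3) and `c₂ > 0` (at distance 2) occur as counts, and `a ≤ b`.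
  obtain rfl : a = 0 := by omega
  obtain rfl : b = ic 2 := by omega
  by_cases hne : a' ≠ 0 ∧ b' ≠ ic 2
  · exact Or.inr hne
  left
  obtain ⟨rfl, rfl⟩ := hsd.isDeza.params_eq_of_isCospectral hconn hdeza hcosp hba' (by tauto)
  obtain ⟨rfl, f, -, hA, hJ⟩ := hcosp.exists_algEquiv hconn hreg hdeza.regular
  have hiff : ∀ v w, (G.childA 0).Adj v w ↔ G.dist v w = 3 := fun v w => by
    change v ≠ w ∧ (G.commonNeighbors v w).ncard = 0 ↔ _
    by_cases hvw : v = w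
    · subst hvw; simp
    · rw [hcom hvw]
      split_ifs with h <;> simp [hvw, h, hc2]
  have hP : f ((G.childA 0).adjMatrix ℝ) = (G'.childA 0).adjMatrix ℝ := by
    rw [hsd.isDeza.adjMatrix_childA hba', hdeza.adjMatrix_childA hba', map_sub, map_sub, map_one,
      hJ]
    congr 1
    have e := congrArg f hsd.isDeza.adjMatrix_sq
    rw [map_mul, hA, hdeza.adjMatrix_sq, map_add, map_add, map_smul, map_smul, map_smul, map_one,
      hJ] at e
    -- Comparing the two Deza identities, the factor `b - a = c₂` is nonzero and cancels.
    refine (smul_right_injective (Matrix W W ℝ) (r := (ic 2 : ℝ) - ((0 : ℕ) : ℝ)) ?_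
      (add_left_cancel e)).symm
    simpa using hc2
  -- The `(v, w)` entry of `A A₃` counts neighbours of `v` at distance 3 from `w`: none if `d(v, w)
  -- ≤ 1`, `b₂` at distance 2, `a₃` at distance 3.
  have hmul : G.adjMatrix ℝ * (G.childA 0).adjMatrix ℝ =
      (ib 2 : ℝ) • (allOnes V - 1 - G.adjMatrix ℝ - (G.childA 0).adjMatrix ℝ) +
        (ia 3 : ℝ) • (G.childA 0).adjMatrix ℝ := by
    ext v w
    rw [adjMatrix_mul_adjMatrix_apply]
    simp only [Matrix.add_apply, Matrix.sub_apply, Matrix.smul_apply, allOnes_apply,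
      adjMatrix_apply, hiff, smul_eq_mul]
    simp only [dist_comm (v := w)]
    have hfar : G.dist w v ≤ 1 → {z | G.Adj v z ∧ G.dist w z = 3}.ncard = 0 := fun h => by
      rw [Set.ncard_eq_zero, Set.eq_empty_iff_forall_notMem]
      rintro z ⟨h1, h2⟩
      have h3 := hconn.dist_triangle (u := w) (v := v) (w := z)
      rw [dist_eq_one_iff_adj.2 h1] at h3
      omega
    have hle := hdr.dist_le w v
    obtain h | h | h | h : G.dist w v = 0 ∨ G.dist w v = 1 ∨ G.dist w v = 2 ∨ G.dist w v = 3 := by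
      omega
    · obtain rfl := hconn.dist_eq_zero_iff.1 h
      simp [hfar (by simp)]
    · have hadj := dist_eq_one_iff_adj.1 h
      simp [hfar h.le, h, hadj.symm, one_apply_ne hadj.ne']
    · have hadj : ¬ G.Adj v w := fun h' => by
        rw [dist_eq_one_iff_adj.2 h'.symm] at h; omega
      have hvw : v ≠ w := by rintro rfl; simp at h
      simp [hdr.card_succ 2 (by norm_num) w v h, h, hadj, one_apply_ne hvw]
    · have hadj : ¬ G.Adj v w := fun h' => by
        rw [dist_eq_one_iff_adj.2 h'.symm] at h; omega
      have hvw : v ≠ w := by rintro rfl; simp at h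
      simp [hdr.card_same 3 le_rfl w v h, h, hadj, one_apply_ne hvw]
  have hsum : ∀ i ≤ 3, ib i + ia i + ic i = k' := fun i hi => by
    obtain ⟨w, hw⟩ : ∃ w, G.dist x w = i := by
      obtain rfl | rfl | rfl | rfl : i = 0 ∨ i = 1 ∨ i = 2 ∨ i = 3 := by omega
      · exact ⟨x, dist_self⟩
      · exact ⟨u, dist_eq_one_iff_adj.2 hxu⟩
      · exact ⟨v, hxv⟩
      · exact ⟨y, hxy⟩
    rw [← hdr.card_succ i hi x w hw, ← hdr.card_same i hi x w hw, ← hdr.card_pred i hi x w hw,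
      hconn.ncard_add_ncard_add_ncard hw, hreg]
  refine isDistanceRegular_three (m := ic 2) (α := ia 3) (β := ib 2) hdeza.regular ?_
    hdeza.common ?_ ?_ ⟨?_, hac, rfl⟩ rfl ⟨?_, ?_, rfl⟩ hsum ?_
  -- `a₃ < k` because `c₃ > 0`.
  · have := hsum 3 le_rfl
    omega
  · obtain ⟨v, w, hvw, h⟩ := hdeza.exists_a
    exact ⟨v, w, hvw, h⟩
  · have e := congrArg f hmul
    rw [map_mul, map_add, map_smul, map_smul, map_sub, map_sub, map_sub, map_one, hA, hP, hJ] at e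
    exact e
  · rw [← hdr.card_same 0 (by norm_num) x x dist_self, Set.ncard_eq_zero,
      Set.eq_empty_iff_forall_notMem]
    rintro z ⟨h1, h2⟩
    exact h1.ne (hconn.dist_eq_zero_iff.1 h2)
  · rw [← hdr.card_pred 0 (by norm_num) x x dist_self]
    simp
  · rw [← hdr.card_pred 1 (by norm_num) x u (dist_eq_one_iff_adj.2 hxu), Set.ncard_eq_one]
    refine ⟨x, ?_⟩
    ext z
    simp only [Set.mem_ofPred_eq, Set.mem_singleton_iff, Nat.add_eq_right, hconn.dist_eq_zero_iff]
    exact ⟨fun h => h.2.symm, fun h => ⟨h ▸ hxu.symm, h.symm⟩⟩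
  · rw [← hdr.card_succ 3 le_rfl x y hxy, Set.ncard_eq_zero, Set.eq_empty_iff_forall_notMem]
    rintro z ⟨-, h⟩
    have := hdr.dist_le x z
    omega
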